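/- Let $k\ge 1$ be an integer, let $I$ be an arbitrary (possibly infinite) index set, and let $(H_i)_{i\in I}$ be complex Hilbert spaces of dimension $2k$. Let $H=\bigotimes_{i\in I}H_i$ be von Neumann's complete tensor product. That is, $H$ is the Hilbert space completion of the span of the elementary tensors $\otimes_i f_i$ of families with convergent $\prod_i\|f_i\|$ (in the sense of limits over finite subsets of $I$, the limit $0$ being allowed), with inner product $\langle\otimes_i f_i,\otimes_i g_i\rangle=\prod_i\langle f_i,g_i\rangle$, where this product is given the value $0$ if it does not converge. Let $HL$ be the Hilbert lattice of $H$, i.e. the orthogonal projections of $H$ ordered by inclusion of ranges. The $|I|$-critical multi-cubic lattice over $\mathbb Z_{2k+1}$ is defined as follows. For $A\subseteq I$ let $X_A$ be the set of vectors in $\prod_{i\in I}\mathbb Z_{2k+1}$ that vanish off $A$. The multi-cubic lattice consists of all cosets $m=a+X_A$. Such a coset contains exactly one critical vector $\Gamma(m)$, namely the one vanishing on $A$; put $\sigma(m)=\{i:\Gamma(m)_i=0\}$. The critical multi-cubic lattice is the quotient by the relation $m\sim n$ iff $X_{\sigma(m)}=X_{\sigma(n)}$ and $\Gamma(m)-\Gamma(n)\in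 X_{\sigma(m)}$, ordered by inclusion of the representing cosets $\Gamma(m)+X_{\sigma(m)}$. It has no bottom element; its minimal elements are called its atoms. Theorem. There is a subset $M\subseteq HL$ which, with the order induced from $HL$, is isomorphic to the $|I|$-critical multi-cubic lattice over $\mathbb Z_{2k+1}$, and there is an orthonormal (Hilbert) basis $(b_p)$ of $H$ indexed by the atoms $p$ of $M$ such that each atom $p$ is the orthogonal projection onto the line $\mathbb C\,b_p$. -/

import Mathlib

open scoped InnerProductSpace ComplexConjugate

/-! ### Multi-cubes and critical multi-cubic lattices -/

/-- `X_A`: the product submodule of `∏_{i ∈ I} ℤ/n` of the vectors vanishing off `A`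
(for finite `I`, the span of the `e_i`, `i ∈ A`). -/
def coordSubmodule {I : Type*} (n : ℕ) (A : Set I) : Submodule (ZMod n) (I → ZMod n) where
  carrier := {v | ∀ i, i ∉ A → v i = 0}
  add_mem' := by
    intro a b ha hb i hi
    simp [ha i hi, hb i hi]
  zero_mem' := by
    intro i _
    rfl
  smul_mem' := by
    intro c a ha i hi
    simp [ha i hi]

/-- The coset `a + X_A`. -/
def coordCoset {I : Type*} {n : ℕ} (a : I → ZMod n) (A : Set I) : Set (I → ZMod n) :=
  {x | x - a ∈ coordSubmodule n A}

/-- The `I`-multi-cubic lattice over `ℤ/n`: all cosets `a + X_A`, ordered by inclusion. -/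
abbrev MultiCube (I : Type*) (n : ℕ) : Type _ :=
  {S : Set (I → ZMod n) // ∃ (a : I → ZMod n) (A : Set I), S = coordCoset a A}

namespace MultiCube

variable {I : Type*} {n : ℕ}

/-- The coordinates that are not constant on `m`: the set `A` of `m = a + X_A`. -/
def free (m : MultiCube I n) : Set I :=
  {i | ∃ x ∈ m.1, ∃ y ∈ m.1, x i ≠ y i}

/-- A vector of the coset `m = a + X_A` is critical if its nonzero coordinates lie off `A`. -/
def IsCritical (m : MultiCube I n) (x : I → ZMod n) : Prop :=
  x ∈ m.1 ∧ ∀ i, x i ≠ 0 → i ∉ m.free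

theorem existsUnique_isCritical (m : MultiCube I n) : ∃! x, m.IsCritical x := by
  classical
  obtain ⟨S, a, A, rfl⟩ := m
  have hfree : ∀ i, i ∈ free ⟨coordCoset a A, a, A, rfl⟩ → i ∈ A := by
    rintro i ⟨x, hx, y, hy, hxy⟩
    by_contra hi
    have h1 := sub_eq_zero.mp (hx i hi)
    have h2 := sub_eq_zero.mp (hy i hi)
    exact hxy (h1.trans h2.symm)
  refine ⟨fun i => if i ∈ A then 0 else a i, ⟨?_, ?_⟩, ?_⟩
  · intro i hi
    simp [hi]
  · intro i hi h
    exact hi (by simp [hfree i h])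
  · rintro y ⟨hy, hy'⟩
    funext i
    by_cases hi : i ∈ A
    · simp only [hi, if_true]
      by_contra h0
      refine hy' i h0 ⟨y, hy, Function.update y i 0, ?_, by simpa using h0⟩
      intro j hj
      have hji : j ≠ i := fun h => hj (h ▸ hi)
      simpa [hji] using hy j hj
    · simp only [hi, if_false]
      exact sub_eq_zero.mp (hy i hi)

/-- `Γ(m)`, the critical vector of `m`. -/
noncomputable def crit (m : MultiCube I n) : I → ZMod n :=
  m.existsUnique_isCritical.choose

/-- `σ(m)`, the set of coordinates where the critical vector vanishes. -/
def sigma (m : MultiCube I n) : Set I := {i | m.crit i = 0}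

/-- Two faces are identified when they have the same `X_σ` and their critical vectors agree
modulo `X_σ`. -/
instance criticalSetoid (I : Type*) (n : ℕ) : Setoid (MultiCube I n) where
  r m m' := m.crit - m'.crit ∈ coordSubmodule n m.sigma ∧
    coordSubmodule n m.sigma = coordSubmodule n m'.sigma
  iseqv :=
    { refl := fun m => ⟨by simp, rfl⟩
      symm := by
        rintro m m' ⟨h, h'⟩
        refine ⟨?_, h'.symm⟩
        rw [← h', ← neg_sub]
        exact neg_mem h
      trans := by
        rintro m m' m'' ⟨h, h'⟩ ⟨g, g'⟩
        refine ⟨?_, h'.trans g'⟩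
        rw [← h'] at g
        simpa using add_mem h g }

end MultiCube

/-- The `|I|`-critical multi-cubic lattice over `ℤ/(2k+1)`. -/
def CriticalMultiCubicLattice (I : Type*) (k : ℕ) : Type _ :=
  Quotient (MultiCube.criticalSetoid I (2 * k + 1))

namespace CriticalMultiCubicLattice

variable {I : Type*} {k : ℕ}

/-- The coset `Γ(m) + X_{σ(m)}` by which the class of `m` is represented. -/
noncomputable def face : CriticalMultiCubicLattice I k → Set (I → ZMod (2 * k + 1)) :=
  Quotient.lift (fun m : MultiCube I (2 * k + 1) => coordCoset m.crit m.sigma) (by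
    rintro m m' ⟨h, h'⟩
    ext x
    change x - m.crit ∈ coordSubmodule _ m.sigma ↔ x - m'.crit ∈ coordSubmodule _ m'.sigma
    rw [← h']
    constructor
    · intro hx
      simpa using add_mem hx h
    · intro hx
      simpa using sub_mem hx h)

theorem face_injective : Function.Injective (face (I := I) (k := k)) := by
  intro p q
  refine Quotient.inductionOn₂ p q ?_
  intro m m' h
  change coordCoset m.crit m.sigma = coordCoset m'.crit m'.sigma at h
  have hm : m.crit ∈ coordCoset m'.crit m'.sigma := by
    rw [← h]
    change m.crit - m.crit ∈ coordSubmodule _ m.sigma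
    simp
  have hm' : m.crit - m'.crit ∈ coordSubmodule _ m'.sigma := hm
  have hs : coordSubmodule (2 * k + 1) m.sigma = coordSubmodule (2 * k + 1) m'.sigma := by
    ext v
    have h1 : m.crit + v ∈ coordCoset m.crit m.sigma ↔ m.crit + v ∈ coordCoset m'.crit m'.sigma :=
      by rw [h]
    have h2 : m.crit + v ∈ coordCoset m.crit m.sigma ↔ v ∈ coordSubmodule _ m.sigma := by
      change m.crit + v - m.crit ∈ coordSubmodule _ m.sigma ↔ _
      simp
    have h3 : m.crit + v ∈ coordCoset m'.crit m'.sigma ↔ v ∈ coordSubmodule _ m'.sigma := by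
      change m.crit + v - m'.crit ∈ coordSubmodule _ m'.sigma ↔ _
      rw [add_sub_right_comm]
      constructor
      · intro hv
        simpa using sub_mem hv hm'
      · intro hv
        exact add_mem hm' hv
    rw [← h2, h1, h3]
  exact Quotient.sound ⟨hs ▸ hm', hs⟩

/-- The order is inclusion of the representing cosets `Γ(m) + X_{σ(m)}`. -/
noncomputable instance : PartialOrder (CriticalMultiCubicLattice I k) :=
  PartialOrder.lift face face_injective

end CriticalMultiCubicLattice

/-! ### von Neumann's complete infinite tensor product -/

/-- The value of a quasi-convergent infinite product of complex numbers: the limit of the finite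
partial products if it exists, and `0` otherwise. -/
noncomputable def quasiProd {I : Type*} (z : I → ℂ) : ℂ :=
  open Classical in if Multipliable z then ∏' i, z i else 0

/-- C-sequences: families of vectors for which the product of the norms converges (the limit `0`
is allowed). -/
abbrev CSeq {I : Type*} (V : I → Type*) [∀ i, NormedAddCommGroup (V i)] : Type _ :=
  {f : ∀ i, V i // Multipliable fun i => ‖f i‖}

/-- All partial products over finite sets far enough out are close to `1`. -/
def TailToOne {I : Type*} (z : I → ℂ) : Prop :=
  ∀ ε : ℝ, 0 < ε → ∃ F₀ : Finset I, ∀ F : Finset I, Disjoint F₀ F → ‖(∏ i ∈ F, z i) - 1‖ < ε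

theorem TailToOne.conj {I : Type*} {z : I → ℂ} (h : TailToOne z) :
    TailToOne fun i => conj (z i) := by
  intro ε hε
  obtain ⟨F₀, hF⟩ := h ε hε
  refine ⟨F₀, fun F hd => ?_⟩
  have h1 : (∏ i ∈ F, conj (z i)) - 1 = conj ((∏ i ∈ F, z i) - 1) := by simp
  rw [h1, Complex.norm_conj]
  exact hF F hd

theorem TailToOne.of_hasProd {I : Type*} {z : I → ℂ} {a : ℂ} (h : HasProd z a) (ha : a ≠ 0) :
    TailToOne z := by
  classical
  intro ε hε
  have hna : 0 < ‖a‖ := norm_pos_iff.mpr ha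
  set δ : ℝ := min (‖a‖ / 2) (ε * ‖a‖ / 8) with hδ
  have hδ0 : 0 < δ := by positivity
  have hδ1 : δ ≤ ‖a‖ / 2 := min_le_left _ _
  have hδ2 : δ ≤ ε * ‖a‖ / 8 := min_le_right _ _
  have h' : Filter.Tendsto (fun s : Finset I => ∏ i ∈ s, z i) Filter.atTop (nhds a) := h
  obtain ⟨F₀, hF₀⟩ := Metric.tendsto_atTop.mp h' δ hδ0
  refine ⟨F₀, fun F hd => ?_⟩
  have h1 := hF₀ F₀ le_rfl
  have h2 := hF₀ (F₀ ∪ F) Finset.subset_union_left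
  rw [Finset.prod_union hd] at h2
  rw [dist_eq_norm] at h1 h2
  set p := ∏ i ∈ F₀, z i
  set q := ∏ i ∈ F, z i
  have hp : ‖a‖ / 2 ≤ ‖p‖ := by
    have := norm_sub_norm_le a p
    rw [norm_sub_rev] at this
    linarith
  have h3 : ‖p * (q - 1)‖ < 2 * δ := by
    have : p * (q - 1) = (p * q - a) - (p - a) := by ring
    rw [this]
    have := norm_sub_le (p * q - a) (p - a)
    linarith
  rw [norm_mul] at h3
  by_contra hcon
  push Not at hcon
  have : ‖a‖ / 2 * ε ≤ ‖p‖ * ‖q - 1‖ := mul_le_mul hp hcon hε.le (norm_nonneg _)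
  nlinarith [mul_pos hε hna]

theorem TailToOne.multipliable {I : Type*} {z : I → ℂ} (h : TailToOne z) : Multipliable z := by
  classical
  obtain ⟨F₁, hF₁⟩ := h 1 one_pos
  set C : ℝ := ‖∏ i ∈ F₁, z i‖ * 2 + 1 with hC
  have hC0 : 0 < C := by positivity
  have hcau : CauchySeq fun s : Finset I => ∏ i ∈ s, z i := by
    rw [Metric.cauchySeq_iff']
    intro ε hε
    obtain ⟨F₂, hF₂⟩ := h (ε / C) (div_pos hε hC0)
    refine ⟨F₁ ∪ F₂, fun s hs => ?_⟩
    have hs' : F₁ ∪ F₂ ⊆ s := hs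
    rw [dist_eq_norm, ← Finset.prod_sdiff hs']
    have h1 : ‖∏ i ∈ F₁ ∪ F₂, z i‖ ≤ C := by
      rw [← Finset.prod_sdiff (Finset.subset_union_left (s₁ := F₁) (s₂ := F₂)), norm_mul]
      have h2 := hF₁ ((F₁ ∪ F₂) \ F₁) Finset.disjoint_sdiff
      have h3 : ‖∏ i ∈ (F₁ ∪ F₂) \ F₁, z i‖ ≤ 2 := by
        have := norm_le_norm_add_norm_sub' (∏ i ∈ (F₁ ∪ F₂) \ F₁, z i) 1
        rw [norm_one] at this
        linarith
      nlinarith [norm_nonneg (∏ i ∈ F₁, z i)]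
    have h4 := hF₂ (s \ (F₁ ∪ F₂))
      (Finset.disjoint_sdiff.mono_left Finset.subset_union_right)
    have h5 : ∀ p q : ℂ, p * q - q = (p - 1) * q := fun p q => by ring
    rw [h5, norm_mul]
    calc _ ≤ ‖∏ i ∈ s \ (F₁ ∪ F₂), z i - 1‖ * C :=
          mul_le_mul_of_nonneg_left h1 (norm_nonneg _)
      _ < ε / C * C := mul_lt_mul_of_pos_right h4 hC0
      _ = ε := div_mul_cancel₀ _ hC0.ne'
  obtain ⟨a, ha⟩ := cauchySeq_tendsto_of_complete hcau
  exact ⟨a, ha⟩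

section Positivity

open scoped ComplexOrder

/-- The semi-inner product on formal linear combinations given by a positive kernel. -/
@[reducible]
noncomputable def kernelCore {X : Type*} (K : Matrix X X ℂ) (hK : K.PosSemidef) :
    PreInnerProductSpace.Core ℂ (X →₀ ℂ) where
  inner u v := u.sum fun x a => v.sum fun y b => conj a * b * K x y
  conj_inner_symm u v := by
    rw [Finsupp.sum_comm]
    simp only [map_finsuppSum]
    refine Finsupp.sum_congr fun x _ => Finsupp.sum_congr fun y _ => ?_
    rw [← hK.isHermitian.apply x y]
    simp [mul_comm]
  re_inner_nonneg u := by
    have h := hK.2 u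
    have h2 := (Complex.le_def.mp h).1
    simpa [mul_assoc, mul_comm, mul_left_comm] using h2
  add_left u v w := by
    rw [Finsupp.sum_add_index'] <;> simp [← Finsupp.sum_add, add_mul]
  smul_left u v r := by
    rw [Finsupp.sum_smul_index] <;> simp [Finsupp.mul_sum, ← mul_assoc]

theorem posSemidef_of_inner {X E : Type*} [NormedAddCommGroup E] [InnerProductSpace ℂ E]
    (v : X → E) : (Matrix.of fun x y => ⟪v x, v y⟫_ℂ).PosSemidef := by
  refine ⟨Matrix.ext fun _ _ => inner_conj_symm _ _, fun u => ?_⟩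
  have h : (u.sum fun x a => u.sum fun y b => star a * ⟪v x, v y⟫_ℂ * b)
      = ⟪u.sum fun x a => a • v x, u.sum fun x a => a • v x⟫_ℂ := by
    simp only [Finsupp.sum, sum_inner]
    refine Finset.sum_congr rfl fun x _ => ?_
    simp only [inner_sum, inner_smul_left, inner_smul_right]
    refine Finset.sum_congr rfl fun y _ => ?_
    simp only [Complex.star_def]
    ring
  simp only [Matrix.of_apply]
  rw [h]
  rw [inner_self_eq_norm_sq_to_K]
  change (0 : ℂ) ≤ ((‖u.sum fun x a => a • v x‖ : ℝ) : ℂ) ^ 2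
  rw [← Complex.ofReal_pow]
  exact Complex.zero_le_real.mpr (sq_nonneg _)

section Kernel

variable {I : Type*} {V : I → Type*} [∀ i, NormedAddCommGroup (V i)]
  [∀ i, InnerProductSpace ℂ (V i)]

theorem posSemidef_prod (F : Finset I) :
    (Matrix.of fun f g : ∀ i, V i => ∏ i ∈ F, ⟪f i, g i⟫_ℂ).PosSemidef := by
  classical
  induction F using Finset.induction_on with
  | empty =>
    have := posSemidef_of_inner (fun _ : ∀ i, V i => (1 : ℂ))
    simpa using this
  | insert i F hi ih =>
    have h := (posSemidef_of_inner (fun f : ∀ i, V i => f i)).hadamard ih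
    have e : (Matrix.of fun f g : ∀ i, V i => ∏ j ∈ insert i F, ⟪f j, g j⟫_ℂ) =
        (Matrix.of fun f g : ∀ i, V i => ⟪f i, g i⟫_ℂ).hadamard
          (Matrix.of fun f g : ∀ i, V i => ∏ j ∈ F, ⟪f j, g j⟫_ℂ) := by
      ext f g
      simp [Finset.prod_insert hi]
    rw [e]
    exact h

theorem tailToOne_trans {f g h : ∀ i, V i} (hff : TailToOne fun i => ⟪f i, f i⟫_ℂ)
    (hgg : TailToOne fun i => ⟪g i, g i⟫_ℂ) (hhh : TailToOne fun i => ⟪h i, h i⟫_ℂ)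
    (hfg : TailToOne fun i => ⟪f i, g i⟫_ℂ) (hgh : TailToOne fun i => ⟪g i, h i⟫_ℂ) :
    TailToOne fun i => ⟪f i, h i⟫_ℂ := by
  classical
  intro ε hε
  obtain ⟨F1, h1⟩ := hff (ε / 8) (by positivity)
  obtain ⟨F2, h2⟩ := hgg (ε / 8) (by positivity)
  obtain ⟨F3, h3⟩ := hhh (ε / 8) (by positivity)
  obtain ⟨F4, h4⟩ := hfg (ε / 8) (by positivity)
  obtain ⟨F5, h5⟩ := hgh (ε / 8) (by positivity)
  refine ⟨F1 ∪ F2 ∪ F3 ∪ F4 ∪ F5, fun F hF => ?_⟩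
  simp only [Finset.disjoint_union_left] at hF
  obtain ⟨⟨⟨⟨d1, d2⟩, d3⟩, d4⟩, d5⟩ := hF
  replace h1 := h1 F d1
  replace h2 := h2 F d2
  replace h3 := h3 F d3
  replace h4 := h4 F d4
  replace h5 := h5 F d5
  let K : Matrix (∀ i, V i) (∀ i, V i) ℂ := Matrix.of fun f g => ∏ i ∈ F, ⟪f i, g i⟫_ℂ
  have hK : K.PosSemidef := posSemidef_prod F
  let c := kernelCore K hK
  let : SeminormedAddCommGroup ((∀ i, V i) →₀ ℂ) :=
    @InnerProductSpace.Core.toSeminormedAddCommGroup ℂ _ _ _ _ c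
  let : InnerProductSpace ℂ ((∀ i, V i) →₀ ℂ) := .ofCore c
  have hin : ∀ x y : ∀ i, V i, ⟪(Finsupp.single x (1 : ℂ) : (∀ i, V i) →₀ ℂ),
      Finsupp.single y (1 : ℂ)⟫_ℂ = ∏ i ∈ F, ⟪x i, y i⟫_ℂ := by
    intro x y
    change (Finsupp.single x (1 : ℂ)).sum (fun x a => (Finsupp.single y (1 : ℂ)).sum
      fun y b => conj a * b * K x y) = _
    simp [K]
  rw [← hin] at h1 h2 h3 h4 h5 ⊢
  generalize (Finsupp.single f (1 : ℂ) : (∀ i, V i) →₀ ℂ) = a at *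
  generalize (Finsupp.single g (1 : ℂ) : (∀ i, V i) →₀ ℂ) = b at *
  generalize (Finsupp.single h (1 : ℂ) : (∀ i, V i) →₀ ℂ) = d at *
  have key : ∀ x y : (∀ i, V i) →₀ ℂ, ‖⟪x, x⟫_ℂ - 1‖ < ε / 8 → ‖⟪y, y⟫_ℂ - 1‖ < ε / 8 →
      ‖⟪x, y⟫_ℂ - 1‖ < ε / 8 → ‖x - y‖ ^ 2 < ε / 2 := by
    intro x y hx hy hxy
    have e1 := (abs_lt.mp ((Complex.abs_re_le_norm _).trans_lt hx))
    have e2 := (abs_lt.mp ((Complex.abs_re_le_norm _).trans_lt hy))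
    have e3 := (abs_lt.mp ((Complex.abs_re_le_norm _).trans_lt hxy))
    simp only [Complex.sub_re, Complex.one_re] at e1 e2 e3
    have e4 := norm_sub_sq (𝕜 := ℂ) x y
    have e5 := norm_sq_eq_re_inner (𝕜 := ℂ) x
    have e6 := norm_sq_eq_re_inner (𝕜 := ℂ) y
    simp only [RCLike.re_to_complex] at e4 e5 e6
    rw [e4, e5, e6]
    linarith [e1.2, e2.2, e3.1]
  have k1 := key a b h1 h2 h4
  have h5' : ‖⟪d, b⟫_ℂ - 1‖ < ε / 8 := by
    rw [← inner_conj_symm, ← Complex.norm_conj]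
    simpa using h5
  have k2 := key d b h3 h2 h5'
  have k3 : ‖⟪a - b, d - b⟫_ℂ‖ < ε / 2 := by
    refine (norm_inner_le_norm _ _).trans_lt ?_
    nlinarith [sq_nonneg (‖a - b‖ - ‖d - b‖)]
  have k4 : ⟪a, d⟫_ℂ - 1 = (⟪b, d⟫_ℂ - 1) + (⟪a, b⟫_ℂ - 1) - (⟪b, b⟫_ℂ - 1)
      + ⟪a - b, d - b⟫_ℂ := by
    simp only [inner_sub_left, inner_sub_right]
    ring
  rw [k4]
  refine (norm_add_le _ _).trans_lt ?_
  have := norm_sub_le ((⟪b, d⟫_ℂ - 1) + (⟪a, b⟫_ℂ - 1)) (⟪b, b⟫_ℂ - 1)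
  have := norm_add_le (⟪b, d⟫_ℂ - 1) (⟪a, b⟫_ℂ - 1)
  linarith

/-- An auxiliary equivalence relation on C-sequences; classes are mutually orthogonal. -/
def tailSetoid (V : I → Type*) [∀ i, NormedAddCommGroup (V i)]
    [∀ i, InnerProductSpace ℂ (V i)] : Setoid (CSeq V) where
  r f g := f = g ∨ ((TailToOne fun i => ⟪f.1 i, f.1 i⟫_ℂ) ∧
    (TailToOne fun i => ⟪g.1 i, g.1 i⟫_ℂ) ∧ TailToOne fun i => ⟪f.1 i, g.1 i⟫_ℂ)
  iseqv :=
    { refl := fun f => Or.inl rfl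
      symm := by
        rintro f g (rfl | ⟨h1, h2, h3⟩)
        · exact Or.inl rfl
        · refine Or.inr ⟨h2, h1, ?_⟩
          simpa using h3.conj
      trans := by
        rintro f g h (rfl | ⟨h1, h2, h3⟩) (rfl | ⟨g1, g2, g3⟩)
        · exact Or.inl rfl
        · exact Or.inr ⟨g1, g2, g3⟩
        · exact Or.inr ⟨h1, h2, h3⟩
        · exact Or.inr ⟨h1, g2, tailToOne_trans h1 h2 g2 h3 g3⟩ }

theorem multipliable_inner_self (f : CSeq V) : Multipliable fun i => ⟪f.1 i, f.1 i⟫_ℂ := by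
  have h1 := (f.2.mul f.2).map Complex.ofRealHom.toMonoidHom Complex.continuous_ofReal
  refine h1.congr fun i => ?_
  rw [inner_self_eq_norm_sq_to_K]
  simp [sq]

theorem tailToOne_self {f : CSeq V} (hf : ∏' i, ‖f.1 i‖ ≠ 0) :
    TailToOne fun i => ⟪f.1 i, f.1 i⟫_ℂ := by
  have h1 := (f.2.hasProd.mul f.2.hasProd).map Complex.ofRealHom.toMonoidHom
    Complex.continuous_ofReal
  refine TailToOne.of_hasProd (a := ((∏' i, ‖f.1 i‖) * ∏' i, ‖f.1 i‖ : ℝ)) ?_ ?_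
  · have h2 : (fun i => ⟪f.1 i, f.1 i⟫_ℂ) =
        Complex.ofRealHom.toMonoidHom ∘ fun i => ‖f.1 i‖ * ‖f.1 i‖ := by
      funext i
      rw [inner_self_eq_norm_sq_to_K]
      simp [sq]
    rw [h2]
    exact h1
  · exact_mod_cast mul_ne_zero hf hf

theorem tendsto_of_rel {f g : CSeq V} (h : (tailSetoid V).r f g) :
    Filter.Tendsto (fun F : Finset I => ∏ i ∈ F, ⟪f.1 i, g.1 i⟫_ℂ) Filter.atTop
      (nhds (quasiProd fun i => ⟪f.1 i, g.1 i⟫_ℂ)) := by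
  have hm : Multipliable fun i => ⟪f.1 i, g.1 i⟫_ℂ := by
    rcases h with rfl | ⟨_, _, h⟩
    · exact multipliable_inner_self f
    · exact h.multipliable
  rw [quasiProd, if_pos hm]
  exact hm.hasProd

theorem quasiProd_eq_zero_of_not_rel {f g : CSeq V} (h : ¬ (tailSetoid V).r f g) :
    quasiProd (fun i => ⟪f.1 i, g.1 i⟫_ℂ) = 0 := by
  by_cases hm : Multipliable fun i => ⟪f.1 i, g.1 i⟫_ℂ
  swap
  · rw [quasiProd, if_neg hm]
  rw [quasiProd, if_pos hm]
  by_contra h0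
  have hle : ‖∏' i, ⟪f.1 i, g.1 i⟫_ℂ‖ ≤ (∏' i, ‖f.1 i‖) * ∏' i, ‖g.1 i‖ := by
    refine le_of_tendsto_of_tendsto (Filter.Tendsto.norm hm.hasProd)
      (f.2.hasProd.mul g.2.hasProd) (Filter.Eventually.of_forall fun F => ?_)
    change ‖∏ i ∈ F, ⟪f.1 i, g.1 i⟫_ℂ‖ ≤ ∏ i ∈ F, ‖f.1 i‖ * ‖g.1 i‖
    rw [norm_prod]
    exact Finset.prod_le_prod (fun _ _ => norm_nonneg _) fun i _ => norm_inner_le_norm _ _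
  have hpos : 0 < ‖∏' i, ⟪f.1 i, g.1 i⟫_ℂ‖ := norm_pos_iff.mpr h0
  have hne := (hpos.trans_le hle).ne'
  exact h (Or.inr ⟨tailToOne_self (left_ne_zero_of_mul hne),
    tailToOne_self (right_ne_zero_of_mul hne), TailToOne.of_hasProd hm.hasProd h0⟩)

theorem posSemidef_of_tendsto {X J : Type*} {l : Filter J} [l.NeBot] {A : J → Matrix X X ℂ}
    {B : Matrix X X ℂ} (hA : ∀ j, (A j).PosSemidef)
    (h : ∀ x y, Filter.Tendsto (fun j => A j x y) l (nhds (B x y))) : B.PosSemidef := by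
  refine ⟨Matrix.ext fun x y => ?_, fun u => ?_⟩
  · refine tendsto_nhds_unique ((h y x).star) ?_
    exact (h x y).congr fun j => ((hA j).isHermitian.apply x y).symm
  · have ht : Filter.Tendsto
        (fun j => u.sum fun x a => u.sum fun y b => star a * A j x y * b) l
        (nhds (u.sum fun x a => u.sum fun y b => star a * B x y * b)) := by
      refine tendsto_finsetSum _ fun x _ => tendsto_finsetSum _ fun y _ => ?_
      exact ((h x y).const_mul _).mul_const _
    exact ge_of_tendsto' ht fun j => (hA j).2 u

/-- The kernel `(f, g) ↦ ∏_i ⟪f_i, g_i⟫` on C-sequences, with quasi-convergent products. -/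
noncomputable def tensorKernel (V : I → Type*) [∀ i, NormedAddCommGroup (V i)]
    [∀ i, InnerProductSpace ℂ (V i)] : Matrix (CSeq V) (CSeq V) ℂ :=
  Matrix.of fun f g => quasiProd fun i => ⟪f.1 i, g.1 i⟫_ℂ

theorem tensorKernel_posSemidef : (tensorKernel V).PosSemidef := by
  classical
  let e : CSeq V → lp (fun _ : Quotient (tailSetoid V) => ℂ) 2 :=
    fun f => lp.single 2 (Quotient.mk _ f) (1 : ℂ)
  have hB := posSemidef_of_inner e
  have hBe : ∀ f g, ⟪e f, e g⟫_ℂ = if (tailSetoid V).r f g then 1 else 0 := by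
    intro f g
    simp only [e, lp.inner_single_left]
    by_cases hfg : (tailSetoid V).r f g
    · have : (Quotient.mk (tailSetoid V) f) = Quotient.mk _ g := Quotient.sound hfg
      simp [hfg, this]
    · have : (Quotient.mk (tailSetoid V) f) ≠ Quotient.mk _ g := fun h => hfg (Quotient.exact h)
      simp [hfg, this]
  refine posSemidef_of_tendsto (l := (Filter.atTop : Filter (Finset I)))
    (A := fun F => ((Matrix.of fun f g : ∀ i, V i => ∏ i ∈ F, ⟪f i, g i⟫_ℂ).submatrix
      (fun f : CSeq V => f.1) (fun f : CSeq V => f.1)).hadamard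
      (Matrix.of fun x y => ⟪e x, e y⟫_ℂ))
    (fun F => ((posSemidef_prod F).submatrix _).hadamard hB) ?_
  intro f g
  by_cases hfg : (tailSetoid V).r f g
  · simpa [hBe, hfg, tensorKernel] using tendsto_of_rel hfg
  · simp [hBe, hfg, tensorKernel, quasiProd_eq_zero_of_not_rel hfg]

end Kernel

end Positivity

section CompleteTensorProduct

variable {I : Type*} (V : I → Type*) [∀ i, NormedAddCommGroup (V i)]
  [∀ i, InnerProductSpace ℂ (V i)]

/-- Formal finite linear combinations of C-sequences, with the semi-inner product extending
`⟪f, g⟫ = ∏_i ⟪f_i, g_i⟫`. -/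
def PreTensorProduct : Type _ := CSeq V →₀ ℂ

namespace PreTensorProduct

noncomputable instance : AddCommGroup (PreTensorProduct V) :=
  inferInstanceAs (AddCommGroup (CSeq V →₀ ℂ))

noncomputable instance : Module ℂ (PreTensorProduct V) :=
  inferInstanceAs (Module ℂ (CSeq V →₀ ℂ))

noncomputable instance : PreInnerProductSpace.Core ℂ (PreTensorProduct V) :=
  kernelCore (tensorKernel V) tensorKernel_posSemidef

noncomputable instance : SeminormedAddCommGroup (PreTensorProduct V) :=
  InnerProductSpace.Core.toSeminormedAddCommGroup (𝕜 := ℂ)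

noncomputable instance : InnerProductSpace ℂ (PreTensorProduct V) := .ofCore _

/-- The generator of a C-sequence. -/
noncomputable def single {V} [∀ i : I, NormedAddCommGroup (V i)]
    [∀ i, InnerProductSpace ℂ (V i)] (f : CSeq V) : PreTensorProduct V :=
  Finsupp.single f (1 : ℂ)

theorem inner_single (f g : CSeq V) :
    ⟪single f, single g⟫_ℂ = quasiProd fun i => ⟪f.1 i, g.1 i⟫_ℂ := by
  change (Finsupp.single f (1 : ℂ)).sum (fun x a => (Finsupp.single g (1 : ℂ)).sum
    fun y b => conj a * b * tensorKernel V x y) = _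
  simp [tensorKernel]

end PreTensorProduct

/-- von Neumann's complete tensor product `⨂_{i ∈ I} V i`: the Hilbert space completion of the
span of the elementary tensors of C-sequences (null vectors being identified with `0`). -/
abbrev CompleteTensorProduct : Type _ := UniformSpace.Completion (PreTensorProduct V)

variable {V}

/-- The elementary tensor `⨂_i f_i` of a C-sequence. -/
noncomputable def elementaryTensor (f : CSeq V) : CompleteTensorProduct V :=
  (PreTensorProduct.single f : UniformSpace.Completion (PreTensorProduct V))

theorem inner_elementaryTensor (f g : CSeq V) :
    ⟪elementaryTensor f, elementaryTensor g⟫_ℂ = quasiProd fun i => ⟪f.1 i, g.1 i⟫_ℂ := by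
  rw [elementaryTensor, elementaryTensor, UniformSpace.Completion.inner_coe,
    PreTensorProduct.inner_single]

end CompleteTensorProduct

/-! ### The Hilbert lattice -/

/-- The Hilbert lattice of `H`: the orthogonal projections of `H`, with the order of operators,
which for projections is inclusion of ranges. -/
abbrev HilbertLattice (H : Type*) [NormedAddCommGroup H] [InnerProductSpace ℂ H]
    [CompleteSpace H] : Type _ :=
  {p : H →L[ℂ] H // IsStarProjection p}

theorem HilbertLattice.le_iff_range_le {H : Type*} [NormedAddCommGroup H]
    [InnerProductSpace ℂ H] [CompleteSpace H] (p q : HilbertLattice H) :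
    p ≤ q ↔ p.1.range ≤ q.1.range := by
  have hp := (p.1.isStarProjection_iff_isSymmetricProjection).mp p.2
  have hq := (q.1.isStarProjection_iff_isSymmetricProjection).mp q.2
  rw [← LinearMap.IsSymmetricProjection.le_iff_range_le_range hp hq]
  exact Subtype.coe_le_coe.symm.trans (ContinuousLinearMap.coe_le_coe_iff _ _).symm

/-!
The critical vector of a face identifies the critical multi-cubic lattice with the set of all
vectors `a : I → ℤ/(2k+1)`, the face of `a` being free exactly in the coordinates where `a`
vanishes. The minimal faces are the single nowhere vanishing vectors, and since there are at least
two nonzero labels in `ℤ/(2k+1)`, a face is determined by the minimal faces it contains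
(`CriticalMultiCubicLattice.labels_subset_labels`). Consequently, any Hilbert basis `b` of a
Hilbert space indexed by the nowhere vanishing vectors yields an order embedding into the Hilbert
lattice: a face goes to the projection onto the closed span of the `b v` with `v` in the face, and
the atoms go to the projections onto the lines `ℂ b v`
(`exists_critical_lattice_of_hilbertBasis`).

It remains to see that the complete tensor product `H` has a Hilbert basis indexed by `I → J`, where
`J` is the set of the `2k` nonzero labels (`exists_hilbertBasis_completeTensorProduct`). With
orthonormal bases `e i` of the factors indexed by `J`, the product vectors `⨂_i e_i^{v_i}`,
`v : I → J`, are orthonormal. If `I` is finite they are total by Parseval's identity. If `I` is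
infinite they are not: for instance, `⨂_i (e i j + e i j') / √2` with `j ≠ j'`
is orthogonal to all of them. Extend them to a Hilbert basis. It has at least `#(I → J)`
members, and at most as many as there are elementary tensors times `ℵ₀`, because each elementary
tensor is orthogonal to all but countably many members (`exists_embedding_of_orthonormal`). Both
bounds equal `2 ^ #I` (`nonempty_embedding_fun_of_infinite`), so the basis can be indexed by
`I → J`.
-/

/-! ### Faces of the critical multi-cubic lattice -/

/-- The nonzero elements of `ℤ/(2k+1)`. They index an orthonormal basis of a tensor factor, and
functions `I → NonzeroLabel k` are the nowhere vanishing vectors of `∏_{i ∈ I} ℤ/(2k+1)`. -/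
abbrev NonzeroLabel (k : ℕ) : Type := {z : ZMod (2 * k + 1) // z ≠ 0}

theorem card_nonzeroLabel (k : ℕ) : Fintype.card (NonzeroLabel k) = 2 * k := by
  rw [Fintype.card_subtype_compl, ZMod.card]
  simp

theorem nontrivial_nonzeroLabel {k : ℕ} (hk : 1 ≤ k) : Nontrivial (NonzeroLabel k) := by
  rw [← Fintype.one_lt_card_iff_nontrivial, card_nonzeroLabel]
  omega

namespace CriticalMultiCubicLattice

variable {I : Type*} {k : ℕ}

theorem le_iff_face_subset (p q : CriticalMultiCubicLattice I k) :
    p ≤ q ↔ p.face ⊆ q.face :=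
  Iff.rfl

/-- The coset with critical vector `a` that is free in all the coordinates where `a` vanishes. -/
def faceOf (a : I → ZMod (2 * k + 1)) : Set (I → ZMod (2 * k + 1)) :=
  coordCoset a {i | a i = 0}

theorem mem_faceOf {a x : I → ZMod (2 * k + 1)} :
    x ∈ faceOf a ↔ ∀ i, a i ≠ 0 → x i = a i :=
  forall_congr' fun _ => imp_congr_right fun _ => sub_eq_zero

theorem exists_face_eq_faceOf (p : CriticalMultiCubicLattice I k) :
    ∃ a, p.face = faceOf a :=
  Quotient.inductionOn p fun m => ⟨m.crit, rfl⟩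

theorem exists_faceOf_eq_face (a : I → ZMod (2 * k + 1)) :
    ∃ p : CriticalMultiCubicLattice I k, p.face = faceOf a := by
  let m : MultiCube I (2 * k + 1) := ⟨coordCoset a {i | a i = 0}, a, _, rfl⟩
  have hm : m.IsCritical a := by
    refine ⟨mem_faceOf.mpr fun _ _ => rfl, ?_⟩
    rintro i hi ⟨x, hx, y, hy, hxy⟩
    exact hxy ((mem_faceOf.mp hx i hi).trans (mem_faceOf.mp hy i hi).symm)
  have hc : m.crit = a := m.existsUnique_isCritical.unique
    m.existsUnique_isCritical.choose_spec.1 hm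
  refine ⟨Quotient.mk _ m, ?_⟩
  change coordCoset m.crit {i | m.crit i = 0} = _
  rw [hc, faceOf]

/-- The nowhere vanishing vectors in the face of `p`; they correspond to the atoms below `p`. -/
def labels (p : CriticalMultiCubicLattice I k) : Set (I → NonzeroLabel k) :=
  {v | (fun i => (v i : ZMod (2 * k + 1))) ∈ p.face}

/-- The lattice is atomistic: a face is determined by its nowhere vanishing vectors. This needs two
distinct nonzero labels, in order to tell a free coordinate from a fixed one. -/
theorem labels_subset_labels (hk : 1 ≤ k) {p q : CriticalMultiCubicLattice I k} :
    p.labels ⊆ q.labels ↔ p ≤ q := by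
  classical
  have := nontrivial_nonzeroLabel hk
  refine ⟨fun h => ?_, fun h v hv => h hv⟩
  obtain ⟨a, ha⟩ := exists_face_eq_faceOf p
  obtain ⟨b, hb⟩ := exists_face_eq_faceOf q
  rw [le_iff_face_subset, ha, hb]
  simp only [labels, ha, hb] at h
  intro x hx
  rw [mem_faceOf] at hx ⊢
  intro i hi
  obtain ⟨c, hc⟩ := exists_ne (⟨b i, hi⟩ : NonzeroLabel k)
  let v : I → NonzeroLabel k := fun j => if hj : a j = 0 then c else ⟨a j, hj⟩
  have hv : (fun i => (v i : ZMod (2 * k + 1))) ∈ faceOf a :=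
    mem_faceOf.mpr fun j hj => by simp [v, hj]
  have hvb : (v i : ZMod (2 * k + 1)) = b i := mem_faceOf.mp (h hv) i hi
  by_cases hai : a i = 0
  · exact absurd (Subtype.ext (by simpa [v, hai] using hvb)) hc
  · rw [hx i hai]
    simpa [v, hai] using hvb

theorem faceOf_coe (v : I → NonzeroLabel k) :
    faceOf (fun i => (v i : ZMod (2 * k + 1))) = {fun i => (v i : ZMod (2 * k + 1))} := by
  ext x
  rw [mem_faceOf, Set.mem_singleton_iff, funext_iff]
  exact forall_congr' fun i => ⟨fun h => h (v i).2, fun h _ => h⟩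

/-- The atom of the lattice given by a nowhere vanishing vector. -/
noncomputable def atom (v : I → NonzeroLabel k) : CriticalMultiCubicLattice I k :=
  (exists_faceOf_eq_face fun i => (v i : ZMod (2 * k + 1))).choose

theorem face_atom (v : I → NonzeroLabel k) :
    (atom v).face = {fun i => (v i : ZMod (2 * k + 1))} :=
  (exists_faceOf_eq_face _).choose_spec.trans (faceOf_coe v)

theorem labels_atom (v : I → NonzeroLabel k) : (atom v).labels = {v} := by
  ext u
  simp only [labels, face_atom, Set.mem_singleton_iff, Set.mem_ofPred_eq, funext_iff,
    Subtype.ext_iff]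

theorem atom_injective : Function.Injective (atom (I := I) (k := k)) := fun u v h =>
  Set.singleton_injective (by rw [← labels_atom, ← labels_atom, h])

theorem isMin_atom (v : I → NonzeroLabel k) : IsMin (atom v) := by
  intro p hp
  obtain ⟨a, ha⟩ := exists_face_eq_faceOf p
  rw [le_iff_face_subset, face_atom] at hp ⊢
  have hmem : a ∈ p.face := ha ▸ mem_faceOf.mpr fun _ _ => rfl
  rw [Set.singleton_subset_iff, ← Set.mem_singleton_iff.mp (hp hmem)]
  exact hmem

theorem isMin_iff_exists_atom (hk : 1 ≤ k) {p : CriticalMultiCubicLattice I k} :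
    IsMin p ↔ ∃ v, atom v = p := by
  classical
  refine ⟨fun h => ?_, ?_⟩
  · have := nontrivial_nonzeroLabel hk
    obtain ⟨c⟩ : Nonempty (NonzeroLabel k) := inferInstance
    obtain ⟨a, ha⟩ := exists_face_eq_faceOf p
    let v : I → NonzeroLabel k := fun j => if hj : a j = 0 then c else ⟨a j, hj⟩
    refine ⟨v, h.eq_of_le ?_⟩
    rw [le_iff_face_subset, face_atom, Set.singleton_subset_iff, ha, mem_faceOf]
    intro j hj
    simp [v, hj]
  · rintro ⟨v, rfl⟩
    exact isMin_atom v

end CriticalMultiCubicLattice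

/-! ### Embedding the lattice along a Hilbert basis -/

section Embedding

variable {ι H : Type*} [NormedAddCommGroup H] [InnerProductSpace ℂ H]

/-- The closed span of the members of the basis `b` with index in `S`. -/
def basisSubspace (b : HilbertBasis ι ℂ H) (S : Set ι) : Submodule ℂ H :=
  (Submodule.span ℂ (b '' S)).topologicalClosure

theorem mem_basisSubspace_iff (b : HilbertBasis ι ℂ H) {S : Set ι} {i : ι} :
    b i ∈ basisSubspace b S ↔ i ∈ S := by
  refine ⟨fun h => ?_, fun h => Submodule.le_topologicalClosure _
    (Submodule.subset_span ⟨i, h, rfl⟩)⟩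
  by_contra hi
  have hle : basisSubspace b S ≤ (Submodule.span ℂ {b i})ᗮ := by
    refine Submodule.topologicalClosure_minimal _ (Submodule.span_le.mpr ?_)
      (Submodule.isClosed_orthogonal _)
    rintro _ ⟨j, hj, rfl⟩
    rw [SetLike.mem_coe, Submodule.mem_orthogonal_singleton_iff_inner_right]
    exact b.orthonormal.2 fun h => hi (h ▸ hj)
  have h0 := Submodule.mem_orthogonal_singleton_iff_inner_right.mp (hle h)
  exact b.orthonormal.ne_zero i (inner_self_eq_zero.mp h0)

theorem basisSubspace_le_iff (b : HilbertBasis ι ℂ H) {S T : Set ι} :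
    basisSubspace b S ≤ basisSubspace b T ↔ S ⊆ T :=
  ⟨fun h _ hi => (mem_basisSubspace_iff b).mp (h ((mem_basisSubspace_iff b).mpr hi)),
    fun h => Submodule.topologicalClosure_mono (Submodule.span_mono (Set.image_mono h))⟩

theorem basisSubspace_singleton (b : HilbertBasis ι ℂ H) (i : ι) :
    basisSubspace b {i} = Submodule.span ℂ {b i} := by
  rw [basisSubspace, Set.image_singleton]
  exact (Submodule.closed_of_finiteDimensional _).submodule_topologicalClosure_eq

variable [CompleteSpace H]

instance (b : HilbertBasis ι ℂ H) (S : Set ι) : CompleteSpace (basisSubspace b S) :=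
  (Submodule.isClosed_topologicalClosure _).completeSpace_coe

/-- The orthogonal projection onto the closed span of the `b i`, `i ∈ S`. -/
noncomputable def basisProjection (b : HilbertBasis ι ℂ H) (S : Set ι) : HilbertLattice H :=
  ⟨(basisSubspace b S).starProjection, isStarProjection_starProjection⟩

theorem basisProjection_le_iff (b : HilbertBasis ι ℂ H) {S T : Set ι} :
    basisProjection b S ≤ basisProjection b T ↔ S ⊆ T := by
  rw [HilbertLattice.le_iff_range_le, basisProjection, basisProjection,
    Submodule.range_starProjection, Submodule.range_starProjection, basisSubspace_le_iff]

theorem basisProjection_singleton (b : HilbertBasis ι ℂ H) (i : ι) :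
    (basisProjection b {i}).1 = (Submodule.span ℂ {b i}).starProjection := by
  simp only [basisProjection, basisSubspace_singleton]

/-- Any Hilbert basis indexed by the nowhere vanishing vectors carries a copy of the critical
multi-cubic lattice: a face is sent to the projection onto the closed span of the basis vectors
labelled by it. -/
theorem exists_critical_lattice_of_hilbertBasis {I : Type*} {k : ℕ} (hk : 1 ≤ k)
    (b : HilbertBasis (I → NonzeroLabel k) ℂ H) :
    ∃ M : Set (HilbertLattice H),
      Nonempty (CriticalMultiCubicLattice I k ≃o M) ∧
      ∃ b : HilbertBasis {p : M // IsMin p} ℂ H,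
        ∀ p : {p : M // IsMin p},
          (p.1.1.1 : H →L[ℂ] H) = (Submodule.span ℂ {b p}).starProjection := by
  let f : CriticalMultiCubicLattice I k ↪o HilbertLattice H :=
    OrderEmbedding.ofMapLEIff (fun p => basisProjection b p.labels) fun p q => by
      rw [basisProjection_le_iff, CriticalMultiCubicLattice.labels_subset_labels hk]
  let e : CriticalMultiCubicLattice I k ≃o Set.range f := f.orderIso
  let g : (I → NonzeroLabel k) → {p : Set.range f // IsMin p} := fun v =>
    ⟨e (.atom v), e.isMin_apply.mpr (CriticalMultiCubicLattice.isMin_atom v)⟩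
  have hg : Function.Bijective g := by
    refine ⟨fun u v h => CriticalMultiCubicLattice.atom_injective
      (e.injective (congrArg Subtype.val h)), fun p => ?_⟩
    obtain ⟨v, hv⟩ := (CriticalMultiCubicLattice.isMin_iff_exists_atom hk).mp
      (e.symm.isMin_apply.mpr p.2)
    exact ⟨v, Subtype.ext (by simp only [g, hv, OrderIso.apply_symm_apply])⟩
  let φ := Equiv.ofBijective g hg
  have hspan : ⊤ ≤ (Submodule.span ℂ (Set.range (b ∘ φ.symm))).topologicalClosure := by
    rw [φ.symm.surjective.range_comp, b.dense_span]
  refine ⟨Set.range f, ⟨e⟩, .mk (b.orthonormal.comp _ φ.symm.injective) hspan, fun p => ?_⟩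
  obtain ⟨v, rfl⟩ := φ.surjective p
  rw [HilbertBasis.coe_mk, Function.comp_apply, Equiv.symm_apply_apply,
    ← basisProjection_singleton, ← CriticalMultiCubicLattice.labels_atom]
  rfl

end Embedding

/-! ### Elementary tensors -/

section Tensor

variable {I : Type*} {V : I → Type*} [∀ i, NormedAddCommGroup (V i)]
  [∀ i, InnerProductSpace ℂ (V i)]

theorem PreTensorProduct.induction_smul_single {p : PreTensorProduct V → Prop}
    (zero : p 0) (add : ∀ u v, p u → p v → p (u + v)) (smul : ∀ (c : ℂ) f, p (c • single f))
    (u : PreTensorProduct V) : p u :=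
  Finsupp.induction_linear (motive := p) u zero add fun f c => by
    have h : c • single f = (Finsupp.single f c : CSeq V →₀ ℂ) := Finsupp.smul_single_one f c
    exact h ▸ smul c f

/-- The elementary tensors are total. -/
theorem eq_zero_of_inner_elementaryTensor_eq_zero {x : CompleteTensorProduct V}
    (h : ∀ f : CSeq V, ⟪elementaryTensor f, x⟫_ℂ = 0) : x = 0 := by
  have key : ∀ y : CompleteTensorProduct V, ⟪y, x⟫_ℂ = 0 := by
    intro y
    induction y using UniformSpace.Completion.induction_on with
    | hp => exact isClosed_eq (by fun_prop) continuous_const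
    | ih u =>
      induction u using PreTensorProduct.induction_smul_single with
      | zero => exact inner_zero_left x
      | add u v hu hv =>
        rw [UniformSpace.Completion.coe_add, inner_add_left, hu, hv, add_zero]
      | smul c f =>
        rw [UniformSpace.Completion.coe_smul, inner_smul_left]
        exact mul_eq_zero_of_right _ (h f)
  exact inner_self_eq_zero.mp (key x)

theorem quasiProd_of_fintype [Fintype I] (z : I → ℂ) : quasiProd z = ∏ i, z i := by
  rw [quasiProd, if_pos (hasProd_fintype z).multipliable, tprod_fintype]

theorem quasiProd_eq_zero_of_eq_zero {z : I → ℂ} {i : I} (hi : z i = 0) : quasiProd z = 0 := by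
  rw [quasiProd]
  split_ifs with hz
  · refine tendsto_nhds_unique hz.hasProd (tendsto_const_nhds.congr' ?_)
    filter_upwards [Filter.eventually_ge_atTop {i}] with F hF
    exact (Finset.prod_eq_zero (hF (Finset.mem_singleton_self i)) hi).symm
  · rfl

variable {J : Type} [Fintype J] (e : ∀ i, OrthonormalBasis J ℂ (V i))

/-- The elementary tensor `⨂_i e_i^{v_i}` of members of the orthonormal bases `e_i`. -/
noncomputable def productVector (v : I → J) : CompleteTensorProduct V :=
  elementaryTensor ⟨fun i => e i (v i), by simp [multipliable_one]⟩

theorem inner_productVector (v : I → J) (f : CSeq V) :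
    ⟪productVector e v, elementaryTensor f⟫_ℂ = quasiProd fun i => ⟪e i (v i), f.1 i⟫_ℂ :=
  inner_elementaryTensor _ f

theorem orthonormal_productVector : Orthonormal ℂ (productVector e) := by
  classical
  rw [orthonormal_iff_ite]
  intro u v
  rw [productVector.eq_def e v, inner_productVector]
  split_ifs with h
  · subst h
    have h1 : (fun i => ⟪e i (u i), e i (u i)⟫_ℂ) = fun _ => 1 := by
      funext i
      simp [inner_self_eq_norm_sq_to_K]
    rw [h1, quasiProd, if_pos multipliable_one, tprod_one]
  · obtain ⟨i, hi⟩ := Function.ne_iff.mp h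
    exact quasiProd_eq_zero_of_eq_zero (i := i) ((e i).orthonormal.2 hi)

/-- For finitely many factors the product vectors are total, because Parseval's identity in the
factors multiplies out to Parseval's identity for an elementary tensor. -/
theorem orthogonal_span_productVector_of_finite [Finite I] :
    (Submodule.span ℂ (Set.range (productVector e)))ᗮ = ⊥ := by
  classical
  have := Fintype.ofFinite I
  refine (Submodule.eq_bot_iff _).mpr fun x hx => ?_
  refine eq_zero_of_inner_elementaryTensor_eq_zero fun f => ?_
  have hc : ∀ v, ⟪productVector e v, elementaryTensor f⟫_ℂ = ∏ i, ⟪e i (v i), f.1 i⟫_ℂ :=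
    fun v => by rw [inner_productVector, quasiProd_of_fintype]
  let y := ∑ v, ⟪productVector e v, elementaryTensor f⟫_ℂ • productVector e v
  have hyy : ⟪y, y⟫_ℂ = ⟪elementaryTensor f, elementaryTensor f⟫_ℂ := by
    rw [(orthonormal_productVector e).inner_sum, inner_elementaryTensor, quasiProd_of_fintype]
    simp only [hc, map_prod, ← Finset.prod_mul_distrib, inner_conj_symm]
    rw [← Fintype.prod_sum fun i j => ⟪f.1 i, e i j⟫_ℂ * ⟪e i j, f.1 i⟫_ℂ]
    exact Finset.prod_congr rfl fun i _ => (e i).sum_inner_mul_inner _ _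
  have hyf : ⟪y, elementaryTensor f⟫_ℂ = ⟪y, y⟫_ℂ := by
    rw [(orthonormal_productVector e).inner_sum, sum_inner]
    simp only [inner_smul_left]
  have hfy : ⟪elementaryTensor f, y⟫_ℂ = ⟪y, y⟫_ℂ := by
    rw [← inner_conj_symm, hyf, inner_conj_symm]
  -- Equality in Bessel's inequality: `‖f - y‖² = 0`.
  have hf : elementaryTensor f = y := by
    rw [← sub_eq_zero, ← inner_self_eq_zero (𝕜 := ℂ), inner_sub_sub_self, hfy, hyf, hyy]
    ring
  rw [hf]
  exact hx y (Submodule.sum_mem _ fun v _ =>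
    Submodule.smul_mem _ _ (Submodule.subset_span ⟨v, rfl⟩))

/-! ### The Hilbert dimension -/

/-- Every member of an orthonormal family has a nonzero inner product with some elementary tensor,
and by Bessel's inequality an elementary tensor meets only countably many members in this way.
Elementary tensors are encoded by their coordinates in the bases `e_i`. -/
theorem exists_embedding_of_orthonormal (e : ∀ i, OrthonormalBasis J ℂ (V i))
    {α : Type*} {a : α → CompleteTensorProduct V} (ha : Orthonormal ℂ a) :
    Nonempty (α ↪ (I → J → ℂ) × ℕ) := by
  have hex : ∀ s, ∃ f : CSeq V, ⟪a s, elementaryTensor f⟫_ℂ ≠ 0 := by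
    intro s
    by_contra! h
    exact ha.ne_zero s (eq_zero_of_inner_elementaryTensor_eq_zero fun f =>
      inner_eq_zero_symm.mp (h f))
  choose F hF using hex
  have hcount : ∀ f : CSeq V, Set.Countable {s | ⟪a s, elementaryTensor f⟫_ℂ ≠ 0} := fun f =>
    (ha.inner_products_summable (x := elementaryTensor f)).countable_support.mono
      fun s hs => by simpa using hs
  choose n hn using fun f => Set.countable_iff_exists_injOn.mp (hcount f)
  refine ⟨⟨fun s => (fun i j => ⟪e i j, (F s).1 i⟫_ℂ, n (F s) s), fun s t hst => ?_⟩⟩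
  obtain ⟨h1, h2⟩ := Prod.mk.inj hst
  have hfst : F s = F t := by
    refine Subtype.ext (funext fun i => (e i).repr.injective ?_)
    ext j
    simpa [OrthonormalBasis.repr_apply_apply] using congrFun (congrFun h1 i) j
  refine hn (F s) (hF s) ?_ (by rw [h2, hfst])
  rw [hfst]
  exact hF t

/-- For infinite `I`, both `I → J → ℂ` and `I → J` have cardinality `2 ^ #I`. -/
theorem nonempty_embedding_fun_of_infinite {I : Type*} {J : Type} [Infinite I] [Fintype J]
    [Nontrivial J] : Nonempty ((I → J → ℂ) × ℕ ↪ (I → J)) := by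
  -- Injecting `J → ℂ` into `ℕ → Bool` and `ℕ` into `I → Bool` leaves `((I × ℕ) ⊕ I) → Bool`.
  obtain ⟨r⟩ : Nonempty ((J → ℂ) ↪ (ℕ → Bool)) := by
    rw [← Cardinal.le_def, ← Cardinal.power_def, ← Cardinal.power_def, Cardinal.mk_complex,
      Cardinal.mk_bool, Cardinal.mk_nat, ← Cardinal.two_power_aleph0, ← Cardinal.power_mul]
    exact Cardinal.power_le_power_left two_ne_zero
      (Cardinal.mul_le_of_le le_rfl le_rfl Cardinal.mk_le_aleph0)
  obtain ⟨s⟩ : Nonempty ((I × ℕ) ⊕ I ≃ I) := by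
    rw [← Cardinal.eq]
    simp [Cardinal.mul_aleph0_eq]
  obtain ⟨x, y, hxy⟩ := exists_pair_ne J
  let t : Bool ↪ J := ⟨fun c => cond c x y, by
    intro c d
    cases c <;> cases d <;> simp [hxy, hxy.symm]⟩
  let m : ℕ ↪ (I → Bool) := (Infinite.natEmbedding I).trans
    ⟨fun i => fun j => by classical exact decide (i = j), fun i j h => by
      simpa using congrFun h j⟩
  exact ⟨((r.arrowCongrRight.prodMap m).trans
    (((Equiv.curry I ℕ Bool).symm.prodCongr (.refl _)).trans
      ((Equiv.sumArrowEquivProdArrow _ _ _).symm.trans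
        (s.arrowCongr (.refl _)))).toEmbedding).trans t.arrowCongrRight⟩

/-- The complete tensor product has Hilbert dimension `#(I → J)`. For infinite `I` the product
vectors are not total, and the basis is obtained from a cardinality count instead. -/
theorem exists_hilbertBasis_completeTensorProduct [Nontrivial J]
    (e : ∀ i, OrthonormalBasis J ℂ (V i)) :
    Nonempty (HilbertBasis (I → J) ℂ (CompleteTensorProduct V)) := by
  classical
  have ho := orthonormal_productVector e
  rcases finite_or_infinite I with hI | hI
  · exact ⟨.mkOfOrthogonalEqBot ho (orthogonal_span_productVector_of_finite e)⟩
  obtain ⟨w, b, hw, hb⟩ := ho.toSubtypeRange.exists_hilbertBasis_extension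
  have h1 : (I → J) ↪ w :=
    ⟨fun v => ⟨productVector e v, hw ⟨v, rfl⟩⟩, fun u v h =>
      ho.linearIndependent.injective (congrArg Subtype.val h)⟩
  obtain ⟨h2⟩ := exists_embedding_of_orthonormal e b.orthonormal
  obtain ⟨h3⟩ := nonempty_embedding_fun_of_infinite (I := I) (J := J)
  obtain ⟨φ⟩ := h1.antisymm (h2.trans h3)
  refine ⟨.mk (b.orthonormal.comp φ φ.injective) ?_⟩
  rw [φ.surjective.range_comp, b.dense_span]

end Tensor

/-! ### The lattice inside the Hilbert lattice -/

/-- Minimal elements of `M` play the role of its atoms: the lattice has no bottom element. -/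
theorem mainTheorem3 {I : Type*} (k : ℕ) (hk : 1 ≤ k) (V : I → Type*)
    [∀ i, NormedAddCommGroup (V i)] [∀ i, InnerProductSpace ℂ (V i)]
    (hV : ∀ i, Module.finrank ℂ (V i) = 2 * k) :
    ∃ M : Set (HilbertLattice (CompleteTensorProduct V)),
      Nonempty (CriticalMultiCubicLattice I k ≃o M) ∧
      ∃ b : HilbertBasis {p : M // IsMin p} ℂ (CompleteTensorProduct V),
        ∀ p : {p : M // IsMin p},
          (p.1.1.1 : CompleteTensorProduct V →L[ℂ] CompleteTensorProduct V) =
            (Submodule.span ℂ {b p}).starProjection := by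
  have := nontrivial_nonzeroLabel hk
  have hfin : ∀ i, FiniteDimensional ℂ (V i) := fun i =>
    Module.finite_of_finrank_pos (by rw [hV i]; omega)
  obtain ⟨b⟩ := exists_hilbertBasis_completeTensorProduct fun i =>
    (stdOrthonormalBasis ℂ (V i)).reindex
      (Fintype.equivOfCardEq (by rw [Fintype.card_fin, hV i, card_nonzeroLabel]) :
        Fin (Module.finrank ℂ (V i)) ≃ NonzeroLabel k)
  exact exists_critical_lattice_of_hilbertBasis hk b
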